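/- Let $X$ and $Y$ be compact smooth manifolds with (possibly empty) boundary, and let $f:(Y,\partial Y)\to(X,\partial X)$ be a smooth map of pairs, i.e. a smooth map $f:Y\to X$ with $f(\partial Y)\subseteq\partial X$. A smooth map $g:Y\to X$ is called neat if $g^{-1}(\partial X)=\partial Y$ and, for every $y\in\partial Y$, the differential of $g$ at $y$ induces an isomorphism $T_yY/T_y\partial Y\to T_{g(y)}X/T_{g(y)}\partial X$. Then $f$ is homotopic, relative to $\partial Y$, to a neat map $g:Y\to X$. -/

import Mathlib

open Set Topology
open scoped Manifold ContDiff

/-- The model `I` of manifolds is a model of manifolds with (possibly empty) boundary and without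
corners: its range is the whole vector space `E` or a closed linear half-space of `E`.
This covers both `𝓡 n` (all `n ≥ 0`) and `𝓡∂ n` (all `n ≥ 1`). -/
def IsHalfSpaceModel {E : Type*} [NormedAddCommGroup E] [NormedSpace ℝ E]
    {H : Type*} [TopologicalSpace H] (I : ModelWithCorners ℝ E H) : Prop :=
  range I = univ ∨ ∃ l : E →L[ℝ] ℝ, l ≠ 0 ∧ range I = {v : E | 0 ≤ l v}

/-- The tangent space `T_x ∂M` of the boundary at `x ∈ ∂M`, as a subspace of `T_x M`: it consists
of the velocities `γ'(0)` of the smooth curves `γ : (-ε, ε) → M` which run in `∂M` and satisfy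
`γ 0 = x`. (On a manifold with boundary these velocities form a subspace already; the span only
packs them as one.) -/
noncomputable def boundaryTangentSpace {E : Type*} [NormedAddCommGroup E] [NormedSpace ℝ E]
    {H : Type*} [TopologicalSpace H] (I : ModelWithCorners ℝ E H)
    {M : Type*} [TopologicalSpace M] [ChartedSpace H M] (x : M) :
    Submodule ℝ (TangentSpace I x) :=
  Submodule.span ℝ {v : TangentSpace I x |
    ∃ (γ : ℝ → M) (ε : ℝ), 0 < ε ∧ ContMDiffOn 𝓘(ℝ, ℝ) I ∞ γ (Ioo (-ε) ε) ∧
      (∀ t ∈ Ioo (-ε) ε, γ t ∈ I.boundary M) ∧ γ 0 = x ∧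
      mfderiv 𝓘(ℝ, ℝ) I γ 0 (1 : ℝ) = v}

/-- A map `f : M → N` between manifolds with boundary is neat if it is smooth,
`f ⁻¹ (∂N) = ∂M`, and for every `x ∈ ∂M` the differential of `f` at `x` induces an isomorphism
`T_x M / T_x ∂M → T_{f x} N / T_{f x} ∂N`. -/
structure IsNeat {E : Type*} [NormedAddCommGroup E] [NormedSpace ℝ E]
    {H : Type*} [TopologicalSpace H] (I : ModelWithCorners ℝ E H)
    {F : Type*} [NormedAddCommGroup F] [NormedSpace ℝ F]
    {K : Type*} [TopologicalSpace K] (J : ModelWithCorners ℝ F K)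
    {M : Type*} [TopologicalSpace M] [ChartedSpace H M]
    {N : Type*} [TopologicalSpace N] [ChartedSpace K N] (f : M → N) : Prop where
  contMDiff : ContMDiff I J ∞ f
  preimage_boundary : f ⁻¹' (J.boundary N) = I.boundary M
  bijective_normal : ∀ x ∈ I.boundary M,
    ∃ h : boundaryTangentSpace I x ≤
        (boundaryTangentSpace J (f x)).comap (mfderiv I J f x).toLinearMap,
      Function.Bijective (Submodule.mapQ (boundaryTangentSpace I x)
        (boundaryTangentSpace J (f x)) (mfderiv I J f x).toLinearMap h)

section LinearAlgebra

variable {V : Type*} [NormedAddCommGroup V] [NormedSpace ℝ V]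

theorem exists_apply_eq_one_of_ne_zero {l : V →L[ℝ] ℝ} (hl : l ≠ 0) : ∃ e, l e = 1 := by
  obtain ⟨v, hv⟩ : ∃ v, l v ≠ 0 := by
    by_contra! h
    exact hl (ContinuousLinearMap.ext h)
  exact ⟨(l v)⁻¹ • v, by simp [hv]⟩

/-- A functional which is nonnegative on the half-space `0 ≤ l` is a nonnegative multiple
of `l`. -/
theorem exists_eq_mul_of_nonneg_on_halfSpace {l m : V →L[ℝ] ℝ} (hl : l ≠ 0)
    (h : ∀ v, 0 ≤ l v → 0 ≤ m v) : ∃ c : ℝ, 0 ≤ c ∧ ∀ v, m v = c * l v := by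
  obtain ⟨e, he⟩ := exists_apply_eq_one_of_ne_zero hl
  refine ⟨m e, h e (by simp [he]), fun v ↦ ?_⟩
  have h1 := h (v - l v • e) (by simp [he])
  have h2 := h (l v • e - v) (by simp [he])
  simp only [map_sub, map_smul, smul_eq_mul] at h1 h2
  linarith

theorem interior_setOf_apply_nonneg [CompleteSpace V] {l : V →L[ℝ] ℝ} (hl : l ≠ 0) :
    interior {v : V | 0 ≤ l v} = {v | 0 < l v} := by
  have hs : Function.Surjective l :=
    LinearMap.surjective_of_ne_zero (f := l.toLinearMap) fun h ↦ hl (by ext v; exact congr($h v))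
  have := l.interior_preimage hs (Ici 0)
  rwa [interior_Ici] at this

end LinearAlgebra

section HalfSpace

variable {E : Type*} [NormedAddCommGroup E] [NormedSpace ℝ E]
  {H : Type*} [TopologicalSpace H] {I : ModelWithCorners ℝ E H}
  {M : Type*} [TopologicalSpace M] [ChartedSpace H M]

theorem ModelWithCorners.boundary_eq_empty_of_range_eq_univ (hI : range I = univ) :
    I.boundary M = ∅ := by
  ext x
  simp [ModelWithCorners.boundary, ModelWithCorners.IsBoundaryPoint, hI]

variable {l : E →L[ℝ] ℝ}

theorem apply_extChartAt_nonneg (hI : range I = {v | 0 ≤ l v}) (p x : M) :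
    0 ≤ l (extChartAt I p x) := by
  have : extChartAt I p x ∈ range I := by simp [extChartAt]
  rwa [hI] at this

variable [FiniteDimensional ℝ E]

theorem mem_boundary_iff_apply_extChartAt_eq_zero [IsManifold I ∞ M] (hl : l ≠ 0)
    (hI : range I = {v | 0 ≤ l v}) {p x : M} (hx : x ∈ (extChartAt I p).source) :
    x ∈ I.boundary M ↔ l (extChartAt I p x) = 0 := by
  have : CompleteSpace E := FiniteDimensional.complete ℝ E
  rw [extChartAt_source] at hx
  have h1 : I.IsInteriorPoint x ↔ extChartAt I p x ∈ interior (range I) := by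
    rw [I.isInteriorPoint_iff_of_mem_atlas (n := ∞) (by simp) (chart_mem_atlas H p) hx]
    exact ⟨fun h ↦ (chartAt H p).interior_extend_target_subset_interior_range h,
      fun h ↦ (chartAt H p).mem_interior_extend_target ((chartAt H p).map_source hx) h⟩
  have h2 : x ∈ I.boundary M ↔ ¬ I.IsInteriorPoint x :=
    I.isBoundaryPoint_iff_not_isInteriorPoint x
  rw [h2, h1, hI, interior_setOf_apply_nonneg hl, mem_ofPred_eq, not_lt]
  exact ⟨fun h ↦ h.antisymm (apply_extChartAt_nonneg hI p x), fun h ↦ h.le⟩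

theorem apply_extChartAt_pos [IsManifold I ∞ M] (hl : l ≠ 0)
    (hI : range I = {v | 0 ≤ l v}) {p x : M} (hx : x ∈ (extChartAt I p).source)
    (hxb : x ∉ I.boundary M) : 0 < l (extChartAt I p x) :=
  (apply_extChartAt_nonneg hI p x).lt_of_ne' fun h ↦
    hxb ((mem_boundary_iff_apply_extChartAt_eq_zero hl hI hx).2 h)

/-- At a boundary point, the differential of a function with a local minimum is a nonnegative
multiple of the functional defining the half-space. -/
theorem HasMFDerivAt.exists_eq_mul_of_isLocalMin [IsManifold I ∞ M] (hl : l ≠ 0)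
    (hI : range I = {v | 0 ≤ l v}) {x : M} (hx : x ∈ I.boundary M) {h : M → ℝ} {m : E →L[ℝ] ℝ}
    (hm : HasMFDerivAt I 𝓘(ℝ, ℝ) h x m) (hmin : ∀ᶠ z in 𝓝 x, h x ≤ h z) :
    ∃ c : ℝ, 0 ≤ c ∧ ∀ v, m v = c * l v := by
  refine exists_eq_mul_of_nonneg_on_halfSpace hl fun v hv ↦ ?_
  have hx0 := (mem_boundary_iff_apply_extChartAt_eq_zero hl hI (mem_extChartAt_source x)).1 hx
  refine IsLocalMinOn.hasFDerivWithinAt_nonneg (s := range I) ?_ hm.2 ?_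
  · have ht := (continuousAt_extChartAt_symm (I := I) x).tendsto
    rw [extChartAt_to_inv] at ht
    have := (ht.eventually hmin).filter_mono (nhdsWithin_le_nhds (s := range I))
    filter_upwards [this] with z hz
    change h _ ≤ h _
    rwa [extChartAt_to_inv]
  · refine mem_posTangentConeAt_of_segment_subset
      (I.convex_range.segment_subset (mem_range_self _) ?_)
    rw [hI]
    change 0 ≤ l (extChartAt I x x + v)
    rw [map_add, hx0]
    simpa using hv

theorem exists_pos_apply_mfderiv_extChartAt [IsManifold I ∞ M] (hl : l ≠ 0)
    (hI : range I = {v | 0 ≤ l v}) {p x : M} (hx : x ∈ (extChartAt I p).source)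
    (hxb : x ∈ I.boundary M) :
    ∃ c : ℝ, 0 < c ∧ HasMFDerivAt I 𝓘(ℝ, ℝ) (fun z ↦ l (extChartAt I p z)) x (c • l) := by
  have : IsManifold I 1 M := .of_le (n := ∞) (by simp)
  have h1 : HasMFDerivAt I 𝓘(ℝ, ℝ) (fun z ↦ l (extChartAt I p z)) x
      (l.comp (mfderiv I 𝓘(ℝ, E) (extChartAt I p) x)) := by
    refine HasMFDerivAt.comp (I' := 𝓘(ℝ, E)) x l.hasMFDerivAt ?_
    exact (mdifferentiableAt_extChartAt (by simpa using hx)).hasMFDerivAt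
  have h0 := (mem_boundary_iff_apply_extChartAt_eq_zero hl hI hx).1 hxb
  obtain ⟨c, hc, hc'⟩ := h1.exists_eq_mul_of_isLocalMin hl hI hxb
    (.of_forall fun z ↦ by rw [h0]; exact apply_extChartAt_nonneg hI p z)
  refine ⟨c, hc.lt_of_ne' ?_, ?_⟩
  · rintro rfl
    obtain ⟨e, he⟩ := exists_apply_eq_one_of_ne_zero hl
    obtain ⟨v, hv⟩ := (isInvertible_mfderiv_extChartAt (I := I) hx).surjective e
    have := hc' v
    rw [zero_mul] at this
    exact one_ne_zero (he.symm.trans ((congrArg l hv).symm.trans this))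
  · have h2 : l.comp (mfderiv I 𝓘(ℝ, E) (extChartAt I p) x) = c • l :=
      ContinuousLinearMap.ext fun v ↦ hc' v
    rwa [h2] at h1

theorem mem_boundaryTangentSpace_iff [IsManifold I ∞ M] (hl : l ≠ 0)
    (hI : range I = {v | 0 ≤ l v}) {x : M} (hx : x ∈ I.boundary M) (v : E) :
    (show TangentSpace I x from v) ∈ boundaryTangentSpace I x ↔ l v = 0 := by
  obtain ⟨c, hc, hd⟩ :=
    exists_pos_apply_mfderiv_extChartAt hl hI (mem_extChartAt_source (I := I) x) hx
  have hx0 := (mem_boundary_iff_apply_extChartAt_eq_zero hl hI (mem_extChartAt_source x)).1 hx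
  constructor
  · intro hv
    suffices h : boundaryTangentSpace I x ≤ LinearMap.ker (l.toLinearMap : E →ₗ[ℝ] ℝ) from
      h hv
    refine Submodule.span_le.2 ?_
    rintro _ ⟨γ, ε, hε, hγ, hb, rfl, rfl⟩
    have hIoo : Ioo (-ε) ε ∈ 𝓝 (0 : ℝ) := Ioo_mem_nhds (by linarith) hε
    have hγ0 : MDifferentiableAt 𝓘(ℝ, ℝ) I γ 0 :=
      (hγ.contMDiffAt hIoo).mdifferentiableAt (by simp)
    have hcomp := HasMFDerivAt.comp (0 : ℝ) hd hγ0.hasMFDerivAt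
    have hzero : ((fun z ↦ l (extChartAt I (γ 0) z)) ∘ γ) =ᶠ[𝓝 0] fun _ ↦ (0 : ℝ) := by
      filter_upwards [hIoo, hγ0.continuousAt.preimage_mem_nhds
        (extChartAt_source_mem_nhds (I := I) (γ 0))] with t ht ht'
      exact (mem_boundary_iff_apply_extChartAt_eq_zero hl hI ht').1 (hb t ht)
    have huniq := hasMFDerivAt_unique hcomp
      ((hasMFDerivAt_const (I := 𝓘(ℝ, ℝ)) (I' := 𝓘(ℝ, ℝ)) (0 : ℝ) (0 : ℝ)).congr_of_eventuallyEq
        hzero)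
    have h1 : c * l (mfderiv 𝓘(ℝ, ℝ) I γ 0 (1 : ℝ)) = 0 := congr($huniq (1 : ℝ))
    exact (mul_eq_zero.1 h1).resolve_left hc.ne'
  · intro hv
    have hline : ∀ t : ℝ, extChartAt I x x + t • v ∈ range I := fun t ↦ by
      rw [hI, mem_ofPred_eq, map_add, hx0]; simp [hv]
    have hcont : Continuous fun t : ℝ ↦ extChartAt I x x + t • v := by fun_prop
    obtain ⟨ε, hε, hball⟩ : ∃ ε : ℝ, 0 < ε ∧ ∀ t ∈ Ioo (-ε) ε,
        extChartAt I x x + t • v ∈ (extChartAt I x).target := by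
      have h1 : (extChartAt I x).target ∈ 𝓝[range I] (extChartAt I x x + (0 : ℝ) • v) := by
        simpa using extChartAt_target_mem_nhdsWithin (I := I) x
      have h2 := (tendsto_nhdsWithin_of_tendsto_nhds_of_eventually_within _
        (hcont.tendsto 0) (.of_forall hline)).eventually h1
      obtain ⟨ε, hε, h3⟩ := Metric.eventually_nhds_iff.1 h2
      exact ⟨ε, hε, fun t ht ↦ h3 (by simpa [abs_lt] using ht)⟩
    refine Submodule.subset_span ⟨fun t ↦ (extChartAt I x).symm (extChartAt I x x + t • v), ε, hε,
      ?_, fun t ht ↦ ?_, by simp, ?_⟩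
    · refine (contMDiffOn_extChartAt_symm x).comp (t := (extChartAt I x).target) ?_ hball
      exact ContMDiff.contMDiffOn (contMDiff_iff_contDiff.2 (by fun_prop))
    · rw [mem_boundary_iff_apply_extChartAt_eq_zero hl hI
        ((extChartAt I x).map_target (hball t ht)), (extChartAt I x).right_inv (hball t ht)]
      rw [map_add, hx0]; simp [hv]
    · have hda : HasFDerivAt (fun t : ℝ ↦ extChartAt I x x + t • v)
          (ContinuousLinearMap.toSpanSingleton ℝ v) 0 := by
        have := (((hasDerivAt_id (0 : ℝ)).smul_const v).const_add (extChartAt I x x)).hasFDerivAt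
        simpa using this
      have hm : HasMFDerivAt 𝓘(ℝ, ℝ) I
          (fun t : ℝ ↦ (extChartAt I x).symm (extChartAt I x x + t • v)) 0
          (ContinuousLinearMap.toSpanSingleton ℝ v) := by
        have hIoo : Ioo (-ε) ε ∈ 𝓝 (0 : ℝ) := Ioo_mem_nhds (by linarith) hε
        have key : ∀ t ∈ Ioo (-ε) ε,
            writtenInExtChartAt 𝓘(ℝ, ℝ) I (0 : ℝ)
              (fun t : ℝ ↦ (extChartAt I x).symm (extChartAt I x x + t • v)) t =
            extChartAt I x x + t • v := fun t ht ↦ by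
          change extChartAt I ((extChartAt I x).symm (extChartAt I x x + (0 : ℝ) • v))
            ((extChartAt I x).symm (extChartAt I x x + t • v)) = _
          rw [zero_smul, add_zero, extChartAt_to_inv, (extChartAt I x).right_inv (hball t ht)]
        refine ⟨(((continuousOn_extChartAt_symm x).comp hcont.continuousOn hball).continuousAt
          hIoo), hda.hasFDerivWithinAt.congr_of_eventuallyEq ?_ (key 0 (by simp [hε]))⟩
        filter_upwards [mem_nhdsWithin_of_mem_nhds hIoo] with t ht using key t ht
      rw [hm.mfderiv]
      exact one_smul ℝ v

end HalfSpace

section Neat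

variable {E : Type*} [NormedAddCommGroup E] [NormedSpace ℝ E] [FiniteDimensional ℝ E]
  {H : Type*} [TopologicalSpace H] {I : ModelWithCorners ℝ E H}
  {F : Type*} [NormedAddCommGroup F] [NormedSpace ℝ F] [FiniteDimensional ℝ F]
  {K : Type*} [TopologicalSpace K] {J : ModelWithCorners ℝ F K}
  {M : Type*} [TopologicalSpace M] [ChartedSpace H M] [IsManifold I ∞ M]
  {N : Type*} [TopologicalSpace N] [ChartedSpace K N] [IsManifold J ∞ N]
  {l : E →L[ℝ] ℝ} {k : F →L[ℝ] ℝ}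

/-- The differential of a map of pairs sends inward vectors at the boundary to inward vectors. -/
theorem exists_apply_mfderiv_eq_mul (hl : l ≠ 0) (hI : range I = {v | 0 ≤ l v})
    (hk : k ≠ 0) (hJ : range J = {v | 0 ≤ k v}) {g : M → N} {x : M} (hx : x ∈ I.boundary M)
    (hg : MDifferentiableAt I J g x) (hgx : g x ∈ J.boundary N) :
    ∃ c : ℝ, 0 ≤ c ∧ ∀ v : E, k (mfderiv I J g x v) = c * l v := by
  obtain ⟨d, hd, hd'⟩ :=
    exists_pos_apply_mfderiv_extChartAt hk hJ (mem_extChartAt_source (I := J) (g x)) hgx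
  have hcomp := HasMFDerivAt.comp x hd' hg.hasMFDerivAt
  have h0 := (mem_boundary_iff_apply_extChartAt_eq_zero hk hJ (mem_extChartAt_source _)).1 hgx
  obtain ⟨c, hc, hc'⟩ := hcomp.exists_eq_mul_of_isLocalMin hl hI hx (.of_forall fun z ↦ by
    simp only [Function.comp_apply, h0]
    exact apply_extChartAt_nonneg hJ _ _)
  refine ⟨d⁻¹ * c, by positivity, fun v ↦ ?_⟩
  have h1 : d * k (mfderiv I J g x v) = c * l v := hc' v
  rw [mul_assoc, ← h1, inv_mul_cancel_left₀ hd.ne']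

theorem IsNeat.of_apply_mfderiv_ne_zero (hl : l ≠ 0) (hI : range I = {v | 0 ≤ l v})
    (hk : k ≠ 0) (hJ : range J = {v | 0 ≤ k v}) {g : M → N} (hg : ContMDiff I J ∞ g)
    (hpre : g ⁻¹' J.boundary N = I.boundary M)
    (h : ∀ x ∈ I.boundary M, ∃ v : E, k (mfderiv I J g x v) ≠ 0) : IsNeat I J g := by
  refine ⟨hg, hpre, fun x hx ↦ ?_⟩
  have hgx : g x ∈ J.boundary N := by rwa [← hpre] at hx
  obtain ⟨c, -, hc⟩ := exists_apply_mfderiv_eq_mul hl hI hk hJ hx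
    ((hg x).mdifferentiableAt (by simp)) hgx
  obtain ⟨v₀, hv₀⟩ := h x hx
  have hc0 : c ≠ 0 := by
    rintro rfl
    exact hv₀ (by rw [hc, zero_mul])
  have memI := mem_boundaryTangentSpace_iff hl hI hx
  have memJ := mem_boundaryTangentSpace_iff hk hJ hgx
  have hle : boundaryTangentSpace I x ≤
      (boundaryTangentSpace J (g x)).comap (mfderiv I J g x).toLinearMap := fun v hv ↦
    (memJ _).2 ((hc v).trans (by rw [(memI v).1 hv, mul_zero]))
  refine ⟨hle, ?_, ?_⟩
  · rw [← LinearMap.ker_eq_bot, LinearMap.ker_eq_bot']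
    intro q
    induction q using Submodule.Quotient.induction_on with | _ v
    rw [Submodule.mapQ_apply, Submodule.Quotient.mk_eq_zero, Submodule.Quotient.mk_eq_zero]
    intro hv
    have h1 : c * l v = 0 := (hc v).symm.trans ((memJ _).1 hv)
    exact (memI v).2 ((mul_eq_zero.1 h1).resolve_left hc0)
  · intro q
    induction q using Submodule.Quotient.induction_on with | _ w
    refine ⟨Submodule.Quotient.mk
      (show TangentSpace I x from (k w / k (mfderiv I J g x v₀)) • v₀), ?_⟩
    rw [Submodule.mapQ_apply, Submodule.Quotient.eq]
    refine (memJ _).2 ?_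
    have h1 : ∀ a : ℝ, k (mfderiv I J g x (a • v₀)) = a * k (mfderiv I J g x v₀) := fun a ↦ by
      rw [hc, hc, map_smul, smul_eq_mul]; ring
    refine (map_sub k _ _).trans (sub_eq_zero.2 ((h1 _).trans ?_))
    exact div_mul_cancel₀ _ hv₀

end Neat

section DefiningFunction

variable {E : Type*} [NormedAddCommGroup E] [NormedSpace ℝ E] [FiniteDimensional ℝ E]
  {H : Type*} [TopologicalSpace H] {I : ModelWithCorners ℝ E H}
  {M : Type*} [TopologicalSpace M] [ChartedSpace H M] [IsManifold I ∞ M]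

/-- A compact manifold with boundary carries a smooth nonnegative function which vanishes exactly
on the boundary and whose differential does not vanish there. -/
theorem exists_boundary_definingFunction [CompactSpace M] [T2Space M] {l : E →L[ℝ] ℝ} (hl : l ≠ 0)
    (hI : range I = {v | 0 ≤ l v}) :
    ∃ ρ : M → ℝ, ContMDiff I 𝓘(ℝ, ℝ) ∞ ρ ∧ (∀ x, 0 ≤ ρ x) ∧ (∀ x, ρ x = 0 ↔ x ∈ I.boundary M) ∧
      ∀ x ∈ I.boundary M, ∃ (m : E →L[ℝ] ℝ) (v : E),
        HasMFDerivAt I 𝓘(ℝ, ℝ) ρ x m ∧ l v = 1 ∧ 0 < m v := by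
  let B : ∀ p : M, SmoothBumpFunction I p := fun p ↦ Classical.arbitrary _
  obtain ⟨t, ht⟩ := CompactSpace.elim_nhds_subcover (fun p ↦ Function.support (B p))
    fun p ↦ (B p).support_mem_nhds
  have hcov : ∀ x, ∃ p ∈ t, B p x ≠ 0 := fun x ↦ by
    have : x ∈ ⋃ p ∈ t, Function.support (B p) := ht ▸ mem_univ x
    simpa using this
  let ψ : M → M → ℝ := fun p x ↦ B p x • l (extChartAt I p x)
  have hψ0 : ∀ p x, 0 ≤ ψ p x := fun p x ↦
    mul_nonneg (B p).nonneg (apply_extChartAt_nonneg hI p x)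
  have hψ : ∀ p, ContMDiff I 𝓘(ℝ, ℝ) ∞ (ψ p) := fun p ↦
    (B p).contMDiff_smul (l.contMDiff.comp_contMDiffOn contMDiffOn_extChartAt)
  have hsrc : ∀ {p x}, B p x ≠ 0 → x ∈ (extChartAt I p).source := fun {p x} h ↦ by
    rw [extChartAt_source]; exact (B p).support_subset_source h
  have hle : ∀ p ∈ t, ∀ x, ψ p x ≤ ∑ q ∈ t, ψ q x := fun p hp x ↦
    Finset.single_le_sum (f := fun q ↦ ψ q x) (fun q _ ↦ hψ0 q x) hp
  have hzero : ∀ x ∈ I.boundary M, ∑ p ∈ t, ψ p x = 0 := fun x hx ↦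
    Finset.sum_eq_zero fun p _ ↦ by
      by_cases h : B p x = 0
      · simp [ψ, h]
      · simp only [ψ, (mem_boundary_iff_apply_extChartAt_eq_zero hl hI (hsrc h)).1 hx, smul_zero]
  have hsmooth : ContMDiff I 𝓘(ℝ, ℝ) ∞ fun x ↦ ∑ p ∈ t, ψ p x :=
    contMDiff_finsetSum fun p _ ↦ hψ p
  refine ⟨fun x ↦ ∑ p ∈ t, ψ p x, hsmooth, fun x ↦ Finset.sum_nonneg fun p _ ↦ hψ0 p x,
    fun x ↦ ⟨fun h ↦ ?_, hzero x⟩, fun x hx ↦ ?_⟩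
  · obtain ⟨p, hp, hpx⟩ := hcov x
    by_contra hxb
    have h1 : 0 < ψ p x := mul_pos ((B p).nonneg.lt_of_ne' hpx)
      (apply_extChartAt_pos hl hI (hsrc hpx) hxb)
    linarith [hle p hp x]
  · obtain ⟨e, he⟩ := exists_apply_eq_one_of_ne_zero hl
    obtain ⟨p, hp, hpx⟩ := hcov x
    have hpos : 0 < B p x := (B p).nonneg.lt_of_ne' hpx
    obtain ⟨c, hc, hd⟩ := exists_pos_apply_mfderiv_extChartAt hl hI (hsrc hpx) hx
    have hx0 := (mem_boundary_iff_apply_extChartAt_eq_zero hl hI (hsrc hpx)).1 hx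
    obtain ⟨m, hm⟩ : ∃ m : E →L[ℝ] ℝ, HasMFDerivAt I 𝓘(ℝ, ℝ) (fun x ↦ ∑ p ∈ t, ψ p x) x m :=
      ⟨_, ((hsmooth x).mdifferentiableAt (by simp)).hasMFDerivAt⟩
    have hD := hm.sub (hd.const_smul (B p x / 2))
    obtain ⟨a, ha, ha'⟩ := hD.exists_eq_mul_of_isLocalMin hl hI hx (by
      filter_upwards [(B p).continuous.continuousAt.eventually (lt_mem_nhds (half_lt_self hpos))]
        with z hz
      have h1 : B p x / 2 * l (extChartAt I p z) ≤ B p z * l (extChartAt I p z) :=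
        mul_le_mul_of_nonneg_right hz.le (apply_extChartAt_nonneg hI p z)
      have h2 : B p z * l (extChartAt I p z) ≤ ∑ q ∈ t, ψ q z := hle p hp z
      simp only [Pi.sub_apply, Pi.smul_apply, hzero x hx, hx0, smul_eq_mul]
      linarith)
    refine ⟨m, e, hm, he, ?_⟩
    have h1 : m e - B p x / 2 * (c * l e) = a * l e := ha' e
    rw [he] at h1
    have : 0 < B p x / 2 * (c * 1) := by positivity
    linarith

end DefiningFunction

section Push

variable {F : Type*} [NormedAddCommGroup F] [NormedSpace ℝ F]
  {K : Type*} [TopologicalSpace K] {J : ModelWithCorners ℝ F K}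
  {N : Type*} [TopologicalSpace N] [ChartedSpace K N]

open Classical in
/-- Translate the points in the domain of the chart at `p` in the direction `e`, by the amount
`s` times a cutoff function `χ`. -/
noncomputable def chartPush (J : ModelWithCorners ℝ F K) (p : N) (e : F) (χ : N → ℝ) (s : ℝ)
    (x : N) : N :=
  if x ∈ (extChartAt J p).source then
    (extChartAt J p).symm (extChartAt J p x + (s * χ x) • e)
  else x

variable {p : N} {e : F} {χ : N → ℝ} {C : ℝ}

theorem chartPush_of_mem {x : N} (hx : x ∈ (extChartAt J p).source) (s : ℝ) :
    chartPush J p e χ s x = (extChartAt J p).symm (extChartAt J p x + (s * χ x) • e) :=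
  if_pos hx

theorem chartPush_eq_self {s : ℝ} {x : N} (h : s * χ x = 0) : chartPush J p e χ s x = x := by
  by_cases hx : x ∈ (extChartAt J p).source
  · rw [chartPush_of_mem hx, h, zero_smul, add_zero, (extChartAt J p).left_inv hx]
  · exact if_neg hx

variable (hχ : ∀ x ∈ (extChartAt J p).source, ∀ s ∈ Icc 0 C,
  extChartAt J p x + (s * χ x) • e ∈ (extChartAt J p).target)

include hχ

theorem continuous_chartPush_comp {Z : Type*} [TopologicalSpace Z] (hχc : Continuous χ)
    (hsupp : tsupport χ ⊆ (extChartAt J p).source) {u : Z → N} {s : Z → ℝ} (hu : Continuous u)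
    (hs : Continuous s) (hsC : ∀ z, s z ∈ Icc 0 C) :
    Continuous fun z ↦ chartPush J p e χ (s z) (u z) := by
  refine continuous_iff_continuousAt.2 fun z ↦ ?_
  by_cases hz : u z ∈ (extChartAt J p).source
  · have hopen : IsOpen (u ⁻¹' (extChartAt J p).source) :=
      (isOpen_extChartAt_source p).preimage hu
    have h1 : ContinuousOn (fun z ↦ (extChartAt J p).symm
        (extChartAt J p (u z) + (s z * χ (u z)) • e)) (u ⁻¹' (extChartAt J p).source) := by
      refine (continuousOn_extChartAt_symm p).comp ?_ fun z hz ↦ hχ _ hz _ (hsC z)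
      exact ((continuousOn_extChartAt p).comp hu.continuousOn fun _ h ↦ h).add
        (by fun_prop)
    refine (h1.continuousAt (hopen.mem_nhds hz)).congr ?_
    filter_upwards [hopen.mem_nhds hz] with z hz using (chartPush_of_mem hz _).symm
  · refine hu.continuousAt.congr ?_
    have h1 : (tsupport χ)ᶜ ∈ 𝓝 (u z) :=
      (isClosed_tsupport χ).isOpen_compl.mem_nhds fun h ↦ hz (hsupp h)
    filter_upwards [hu.continuousAt h1] with z hz
    exact (chartPush_eq_self (by rw [image_eq_zero_of_notMem_tsupport hz, mul_zero])).symm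

theorem contMDiff_chartPush_comp [IsManifold J ∞ N] (hχs : ContMDiff J 𝓘(ℝ, ℝ) ∞ χ)
    (hsupp : tsupport χ ⊆ (extChartAt J p).source)
    {E : Type*} [NormedAddCommGroup E] [NormedSpace ℝ E] {H : Type*} [TopologicalSpace H]
    {I : ModelWithCorners ℝ E H} {M : Type*} [TopologicalSpace M] [ChartedSpace H M]
    {u : M → N} {s : M → ℝ} (hu : ContMDiff I J ∞ u)
    (hs : ContMDiff I 𝓘(ℝ, ℝ) ∞ s) (hsC : ∀ z, s z ∈ Icc 0 C) :
    ContMDiff I J ∞ fun z ↦ chartPush J p e χ (s z) (u z) := by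
  intro z
  by_cases hz : u z ∈ (extChartAt J p).source
  · have hopen : IsOpen (u ⁻¹' (extChartAt J p).source) :=
      (isOpen_extChartAt_source p).preimage hu.continuous
    have h1 : ContMDiffOn I J ∞ (fun z ↦ (extChartAt J p).symm
        (extChartAt J p (u z) + (s z * χ (u z)) • e)) (u ⁻¹' (extChartAt J p).source) := by
      refine (contMDiffOn_extChartAt_symm p).comp ?_ fun z hz ↦ hχ _ hz _ (hsC z)
      refine ContMDiffOn.add (contMDiffOn_extChartAt.comp hu.contMDiffOn fun z h ↦ ?_)
        (ContMDiff.contMDiffOn ((hs.mul (hχs.comp hu)).smul contMDiff_const))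
      rw [mem_preimage, extChartAt_source] at h
      exact h
    refine (h1.contMDiffAt (hopen.mem_nhds hz)).congr_of_eventuallyEq ?_
    filter_upwards [hopen.mem_nhds hz] with z hz using chartPush_of_mem hz _
  · refine (hu z).congr_of_eventuallyEq ?_
    have h1 : (tsupport χ)ᶜ ∈ 𝓝 (u z) :=
      (isClosed_tsupport χ).isOpen_compl.mem_nhds fun h ↦ hz (hsupp h)
    filter_upwards [hu.continuous.continuousAt h1] with z hz
    exact chartPush_eq_self (by rw [image_eq_zero_of_notMem_tsupport hz, mul_zero])

theorem chartPush_mem_source {s : ℝ} (hs : s ∈ Icc 0 C) {x : N}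
    (hx : x ∈ (extChartAt J p).source) : chartPush J p e χ s x ∈ (extChartAt J p).source := by
  rw [chartPush_of_mem hx]
  exact (extChartAt J p).map_target (hχ x hx s hs)

theorem extChartAt_chartPush {s : ℝ} (hs : s ∈ Icc 0 C) {x : N}
    (hx : x ∈ (extChartAt J p).source) :
    extChartAt J p (chartPush J p e χ s x) = extChartAt J p x + (s * χ x) • e := by
  rw [chartPush_of_mem hx, (extChartAt J p).right_inv (hχ x hx s hs)]

variable [FiniteDimensional ℝ F] {k : F →L[ℝ] ℝ}

theorem chartPush_notMem_boundary [IsManifold J ∞ N] (hk : k ≠ 0)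
    (hJ : range J = {v | 0 ≤ k v}) (hke : k e = 1) (hχ0 : ∀ x, 0 ≤ χ x)
    (hsupp : tsupport χ ⊆ (extChartAt J p).source) {s : ℝ} (hs : s ∈ Icc 0 C) {x : N}
    (h : x ∉ J.boundary N ∨ s * χ x ≠ 0) : chartPush J p e χ s x ∉ J.boundary N := by
  have hnn : 0 ≤ s * χ x := mul_nonneg hs.1 (hχ0 x)
  by_cases h0 : s * χ x = 0
  · rw [chartPush_eq_self h0]
    exact h.resolve_right (not_not.2 h0)
  · have hx : x ∈ (extChartAt J p).source :=
      hsupp (subset_tsupport χ fun h ↦ h0 (by rw [h, mul_zero]))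
    rw [mem_boundary_iff_apply_extChartAt_eq_zero hk hJ (chartPush_mem_source hχ hs hx),
      extChartAt_chartPush hχ hs hx, map_add, map_smul, hke, smul_eq_mul, mul_one]
    have := apply_extChartAt_nonneg hJ p x
    have := hnn.lt_of_ne' h0
    linarith

end Push

section PushBump

variable {F : Type*} [NormedAddCommGroup F] [NormedSpace ℝ F] [FiniteDimensional ℝ F]
  {K : Type*} [TopologicalSpace K] {J : ModelWithCorners ℝ F K}
  {N : Type*} [TopologicalSpace N] [ChartedSpace K N] [IsManifold J ∞ N] [T2Space N]

theorem exists_chartPush_cutoff {k : F →L[ℝ] ℝ} (hJ : range J = {v | 0 ≤ k v}) {e : F}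
    (hke : k e = 1) {C : ℝ} (hC : 0 ≤ C) (p : N) :
    ∃ χ : N → ℝ, ContMDiff J 𝓘(ℝ, ℝ) ∞ χ ∧ (∀ x, 0 ≤ χ x) ∧ χ p ≠ 0 ∧
      tsupport χ ⊆ (extChartAt J p).source ∧
      ∀ x ∈ (extChartAt J p).source, ∀ s ∈ Icc 0 C,
        extChartAt J p x + (s * χ x) • e ∈ (extChartAt J p).target := by
  let B : SmoothBumpFunction J p := Classical.arbitrary _
  have hR := B.rOut_pos
  let B' : SmoothBumpFunction J p :=
    { rIn := B.rOut / 4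
      rOut := B.rOut / 2
      rIn_pos := by positivity
      rIn_lt_rOut := by linarith
      closedBall_subset := (inter_subset_inter_left _
        (Metric.closedBall_subset_closedBall (by linarith))).trans B.closedBall_subset }
  let δ : ℝ := B.rOut / 2 / ((C + 1) * (‖e‖ + 1))
  have hδ : 0 < δ := by positivity
  refine ⟨fun x ↦ δ • B' x, ((contMDiff_const : ContMDiff J 𝓘(ℝ, ℝ) ∞ fun _ : N ↦ δ)).smul B'.contMDiff, fun x ↦ mul_nonneg hδ.le B'.nonneg,
    by simp [hδ.ne'], (tsupport_smul_subset_right (fun _ ↦ δ) B').trans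
      B'.tsupport_subset_extChartAt_source, fun x hx s hs ↦ ?_⟩
  by_cases h0 : B' x = 0
  · simpa [h0] using (extChartAt J p).map_source hx
  · refine B.closedBall_subset ⟨?_, ?_⟩
    · have h1 : dist (extChartAt J p x) (extChartAt J p p) < B.rOut / 2 := by
        have : x ∈ Function.support B' := h0
        rw [B'.support_eq_inter_preimage] at this
        exact this.2
      have h2 : ‖(s * δ • B' x) • e‖ ≤ B.rOut / 2 := by
        have h3 : 0 ≤ s * δ • B' x := mul_nonneg hs.1 (mul_nonneg hδ.le B'.nonneg)
        rw [norm_smul, Real.norm_of_nonneg h3]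
        calc s * (δ • B' x) * ‖e‖ ≤ (C + 1) * (δ * 1) * (‖e‖ + 1) := by
              have := B'.le_one (x := x)
              have := B'.nonneg (x := x)
              have := hs.2
              rw [smul_eq_mul]
              gcongr <;> linarith
          _ = B.rOut / 2 := by
              simp only [δ]
              field_simp
      rw [Metric.mem_closedBall]
      calc dist (extChartAt J p x + (s * δ • B' x) • e) (extChartAt J p p)
          ≤ dist (extChartAt J p x + (s * δ • B' x) • e) (extChartAt J p x) +
            dist (extChartAt J p x) (extChartAt J p p) := dist_triangle _ _ _
        _ ≤ B.rOut := by rw [dist_self_add_left]; linarith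
    · rw [hJ, mem_ofPred_eq, map_add, map_smul, hke, smul_eq_mul, mul_one]
      exact add_nonneg (apply_extChartAt_nonneg hJ p x)
        (mul_nonneg hs.1 (mul_nonneg hδ.le B'.nonneg))

end PushBump

section Derivative

variable {E : Type*} [NormedAddCommGroup E] [NormedSpace ℝ E]
  {H : Type*} [TopologicalSpace H] {I : ModelWithCorners ℝ E H}
  {F : Type*} [NormedAddCommGroup F] [NormedSpace ℝ F] [FiniteDimensional ℝ F]
  {K : Type*} [TopologicalSpace K] {J : ModelWithCorners ℝ F K}
  {M : Type*} [TopologicalSpace M] [ChartedSpace H M]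
  {N : Type*} [TopologicalSpace N] [ChartedSpace K N] [IsManifold J ∞ N]
  {p : N} {e : F} {χ : N → ℝ} {C : ℝ} {k : F →L[ℝ] ℝ}

/-- Pushing by a multiple of a function `ρ` vanishing at `x` changes the normal component of the
differential at `x` by a positive multiple of `χ (g x)` times the differential of `ρ`. -/
theorem exists_apply_mfderiv_chartPush_comp (hχs : ContMDiff J 𝓘(ℝ, ℝ) ∞ χ)
    (hsupp : tsupport χ ⊆ (extChartAt J p).source)
    (hχ : ∀ x ∈ (extChartAt J p).source, ∀ s ∈ Icc 0 C,
      extChartAt J p x + (s * χ x) • e ∈ (extChartAt J p).target)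
    (hk : k ≠ 0) (hJ : range J = {v | 0 ≤ k v}) (hke : k e = 1)
    {g : M → N} (hg : ContMDiff I J ∞ g) {ρ : M → ℝ} (hρ : ContMDiff I 𝓘(ℝ, ℝ) ∞ ρ)
    (hρC : ∀ z, ρ z ∈ Icc 0 C) {x : M} (hx : ρ x = 0) (hgx : g x ∈ J.boundary N)
    {m : E →L[ℝ] ℝ} (hm : HasMFDerivAt I 𝓘(ℝ, ℝ) ρ x m) :
    ∃ c : ℝ, 0 < c ∧ ∀ v : E,
      k (mfderiv I J (fun z ↦ chartPush J p e χ (ρ z) (g z)) x v) =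
        k (mfderiv I J g x v) + c * χ (g x) * m v := by
  set g' : M → N := fun z ↦ chartPush J p e χ (ρ z) (g z) with hg'
  have hg's : ContMDiff I J ∞ g' := contMDiff_chartPush_comp hχ hχs hsupp hg hρ hρC
  have hg'x : g' x = g x := chartPush_eq_self (by rw [hx, zero_mul])
  by_cases hz : g x ∈ (extChartAt J p).source
  · obtain ⟨c, hc, hd⟩ := exists_pos_apply_mfderiv_extChartAt hk hJ hz hgx
    refine ⟨c⁻¹, by positivity, fun v ↦ ?_⟩
    have h1 := HasMFDerivAt.comp x hd ((hg x).mdifferentiableAt (by simp)).hasMFDerivAt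
    have h2 := HasMFDerivAt.comp x (hg'x.symm ▸ hd)
      ((hg's x).mdifferentiableAt (by simp)).hasMFDerivAt
    obtain ⟨n, hn⟩ : ∃ n : E →L[ℝ] ℝ, HasMFDerivAt I 𝓘(ℝ, ℝ) (χ ∘ g) x n :=
      ⟨_, (((hχs.comp hg) x).mdifferentiableAt (by simp)).hasMFDerivAt⟩
    have h3 := (h1.add (hm.mul hn)).congr_of_eventuallyEq
      (f₁ := (fun z ↦ k (extChartAt J p z)) ∘ g') (by
        filter_upwards [hg.continuous.continuousAt ((isOpen_extChartAt_source p).mem_nhds hz)]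
          with z hz
        simp only [Function.comp_apply, Pi.add_apply, Pi.mul_apply, hg',
          extChartAt_chartPush hχ (hρC z) hz, map_add, map_smul, hke, smul_eq_mul, mul_one])
    have h4 : c * k (mfderiv I J g' x v) =
        c * k (mfderiv I J g x v) + (ρ x * n v + χ (g x) * m v) :=
      congr($(hasMFDerivAt_unique h2 h3) v)
    rw [hx, zero_mul, zero_add] at h4
    field_simp
    linarith
  · refine ⟨1, one_pos, fun v ↦ ?_⟩
    have h1 : (tsupport χ)ᶜ ∈ 𝓝 (g x) :=
      (isClosed_tsupport χ).isOpen_compl.mem_nhds fun h ↦ hz (hsupp h)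
    have h2 : g' =ᶠ[𝓝 x] g := by
      filter_upwards [hg.continuous.continuousAt h1] with z hz
      exact chartPush_eq_self (by rw [image_eq_zero_of_notMem_tsupport hz, mul_zero])
    rw [image_eq_zero_of_notMem_tsupport fun h ↦ hz (hsupp h), h2.mfderiv_eq, mul_zero, zero_mul,
      add_zero]
    rfl

end Derivative

section Perturbation

variable {E : Type*} [NormedAddCommGroup E] [NormedSpace ℝ E]
  {H : Type*} [TopologicalSpace H] {I : ModelWithCorners ℝ E H}
  {F : Type*} [NormedAddCommGroup F] [NormedSpace ℝ F] [FiniteDimensional ℝ F]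
  {K : Type*} [TopologicalSpace K] {J : ModelWithCorners ℝ F K}
  {M : Type*} [TopologicalSpace M] [ChartedSpace H M]
  {N : Type*} [TopologicalSpace N] [ChartedSpace K N] [IsManifold J ∞ N]
  {k : F →L[ℝ] ℝ}

/-- Finitely many chartwise pushes into the interior, by multiples of a function `ρ` which vanishes
exactly on the boundary. -/
theorem exists_homotopicRel_chartPush (hk : k ≠ 0) (hJ : range J = {v | 0 ≤ k v}) {e : F}
    (hke : k e = 1) {C : ℝ} {ρ : M → ℝ} (hρ : ContMDiff I 𝓘(ℝ, ℝ) ∞ ρ)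
    (hρC : ∀ z, ρ z ∈ Icc 0 C) (hρ0 : ∀ z, ρ z = 0 ↔ z ∈ I.boundary M)
    {χ : N → N → ℝ} (hχs : ∀ p, ContMDiff J 𝓘(ℝ, ℝ) ∞ (χ p)) (hχ0 : ∀ p x, 0 ≤ χ p x)
    (hsupp : ∀ p, tsupport (χ p) ⊆ (extChartAt J p).source)
    (hχ : ∀ p, ∀ x ∈ (extChartAt J p).source, ∀ s ∈ Icc 0 C,
      extChartAt J p x + (s * χ p x) • e ∈ (extChartAt J p).target)
    (f : C(M, N)) (hf : ContMDiff I J ∞ f) (hfb : MapsTo f (I.boundary M) (J.boundary N))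
    (t : Finset N) :
    ∃ g : C(M, N), ContMDiff I J ∞ g ∧ f.HomotopicRel g (I.boundary M) ∧
      (∀ z ∉ I.boundary M, g z ∈ J.boundary N → g z = f z ∧ ∀ p ∈ t, χ p (f z) = 0) ∧
      ∀ z ∈ I.boundary M, ∀ (m : E →L[ℝ] ℝ) (v : E), HasMFDerivAt I 𝓘(ℝ, ℝ) ρ z m → 0 < m v →
        k (mfderiv I J f z v) ≤ k (mfderiv I J g z v) ∧
        ((∃ p ∈ t, χ p (f z) ≠ 0) → k (mfderiv I J f z v) < k (mfderiv I J g z v)) := by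
  classical
  induction t using Finset.induction_on with
  | empty => exact ⟨f, hf, .refl f, by simp, by simp⟩
  | insert p t _ ih =>
    obtain ⟨g, hg, hfg, hint, hbd⟩ := ih
    have hρs : ∀ (r : unitInterval) (z : M), (r : ℝ) * ρ z ∈ Icc 0 C := fun r z ↦
      ⟨mul_nonneg r.2.1 (hρC z).1, (mul_le_of_le_one_left (hρC z).1 r.2.2).trans (hρC z).2⟩
    have hcont := continuous_chartPush_comp (hχ p) (hχs p).continuous (hsupp p)
      (g.continuous.comp (continuous_snd (X := unitInterval)))
      ((continuous_subtype_val.comp continuous_fst).mul (hρ.continuous.comp continuous_snd))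
      (fun q : unitInterval × M ↦ hρs q.1 q.2)
    have hsmooth := contMDiff_chartPush_comp (hχ p) (hχs p) (hsupp p) hg hρ hρC
    let g' : C(M, N) := ⟨fun z ↦ chartPush J p e (χ p) (ρ z) (g z), hsmooth.continuous⟩
    have hgg' : g.HomotopicRel g' (I.boundary M) := ⟨
      { toFun := fun q ↦ chartPush J p e (χ p) (q.1 * ρ q.2) (g q.2)
        continuous_toFun := hcont
        map_zero_left := fun z ↦ chartPush_eq_self (by simp)
        map_one_left := fun z ↦ by simp [g']
        prop' := fun r z hz ↦ chartPush_eq_self (by simp [(hρ0 z).2 hz]) }⟩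
    refine ⟨g', hsmooth, hfg.trans hgg', fun z hz hgz ↦ ?_, fun z hz m v hm hv ↦ ?_⟩
    · have hnot := mt (chartPush_notMem_boundary (hχ p) hk hJ hke (hχ0 p) (hsupp p) (hρC z))
        (not_not.2 hgz)
      rw [not_or, not_not, not_not] at hnot
      obtain ⟨hgf, hall⟩ := hint z hz hnot.1
      refine ⟨(chartPush_eq_self hnot.2).trans hgf, ?_⟩
      rw [Finset.forall_mem_insert, ← hgf]
      exact ⟨(mul_eq_zero.1 hnot.2).resolve_left (mt (hρ0 z).1 hz), hgf ▸ hall⟩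
    · have hgz : f z = g z := hfg.fst_eq_snd hz
      obtain ⟨c, hc, hd⟩ := exists_apply_mfderiv_chartPush_comp (hχs p) (hsupp p) (hχ p) hk hJ hke
        hg hρ hρC ((hρ0 z).2 hz) (hgz ▸ hfb hz) hm
      obtain ⟨hle, hlt⟩ := hbd z hz m v hm hv
      have hdv : k (mfderiv I J g' z v) = k (mfderiv I J g z v) + c * χ p (g z) * m v := hd v
      rw [hdv, Finset.exists_mem_insert, hgz]
      rw [hgz] at hlt
      have h0 : 0 ≤ c * χ p (g z) * m v := mul_nonneg (mul_nonneg hc.le (hχ0 p _)) hv.le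
      refine ⟨le_add_of_le_of_nonneg hle h0, ?_⟩
      rintro (h | h)
      · exact lt_add_of_le_of_pos hle (mul_pos (mul_pos hc ((hχ0 p _).lt_of_ne' h)) hv)
      · exact lt_add_of_lt_of_nonneg (hlt h) h0

/-- Into a compact manifold with boundary, a map of pairs can be pushed into the interior relative
to the boundary, with an increase of its normal derivative. -/
theorem exists_homotopicRel_normal_derivative_lt [CompactSpace M] [CompactSpace N] [T2Space N]
    (hk : k ≠ 0) (hJ : range J = {v | 0 ≤ k v}) {ρ : M → ℝ} (hρ : ContMDiff I 𝓘(ℝ, ℝ) ∞ ρ)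
    (hρn : ∀ z, 0 ≤ ρ z) (hρ0 : ∀ z, ρ z = 0 ↔ z ∈ I.boundary M)
    (f : C(M, N)) (hf : ContMDiff I J ∞ f) (hfb : MapsTo f (I.boundary M) (J.boundary N)) :
    ∃ g : C(M, N), ContMDiff I J ∞ g ∧ f.HomotopicRel g (I.boundary M) ∧
      g ⁻¹' J.boundary N = I.boundary M ∧
      ∀ z ∈ I.boundary M, ∀ (m : E →L[ℝ] ℝ) (v : E), HasMFDerivAt I 𝓘(ℝ, ℝ) ρ z m → 0 < m v →
        k (mfderiv I J f z v) < k (mfderiv I J g z v) := by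
  obtain ⟨e, hke⟩ := exists_apply_eq_one_of_ne_zero hk
  obtain ⟨C, hC⟩ := (isCompact_range hρ.continuous).bddAbove
  have hρC : ∀ z, ρ z ∈ Icc 0 (max C 0) := fun z ↦
    ⟨hρn z, (hC (mem_range_self z)).trans (le_max_left _ _)⟩
  choose χ hχs hχ0 hχp hsupp hχ using
    exists_chartPush_cutoff (N := N) hJ hke (le_max_right C 0)
  obtain ⟨t, ht⟩ := CompactSpace.elim_nhds_subcover (fun p ↦ Function.support (χ p)) fun p ↦
    (hχs p).continuous.isOpen_support.mem_nhds (hχp p)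
  have hcov : ∀ x, ∃ p ∈ t, χ p x ≠ 0 := fun x ↦ by
    have : x ∈ ⋃ p ∈ t, Function.support (χ p) := ht ▸ mem_univ x
    simpa using this
  obtain ⟨g, hg, hfg, hint, hbd⟩ :=
    exists_homotopicRel_chartPush hk hJ hke hρ hρC hρ0 hχs hχ0 hsupp hχ f hf hfb t
  refine ⟨g, hg, hfg, Subset.antisymm (fun z hz ↦ ?_) fun z hz ↦ ?_,
    fun z hz m v hm hv ↦ (hbd z hz m v hm hv).2 (hcov _)⟩
  · by_contra hzb
    obtain ⟨p, hp, hpz⟩ := hcov (f z)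
    exact hpz ((hint z hzb hz).2 p hp)
  · rw [mem_preimage, ← hfg.fst_eq_snd hz]
    exact hfb hz

end Perturbation

theorem lemma2p3
    {E : Type*} [NormedAddCommGroup E] [NormedSpace ℝ E] [FiniteDimensional ℝ E]
    {H : Type*} [TopologicalSpace H] (I : ModelWithCorners ℝ E H) (hI : IsHalfSpaceModel I)
    {F : Type*} [NormedAddCommGroup F] [NormedSpace ℝ F] [FiniteDimensional ℝ F]
    {K : Type*} [TopologicalSpace K] (J : ModelWithCorners ℝ F K) (hJ : IsHalfSpaceModel J)
    {Y : Type*} [TopologicalSpace Y] [ChartedSpace H Y] [IsManifold I ∞ Y]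
    [CompactSpace Y] [T2Space Y]
    {X : Type*} [TopologicalSpace X] [ChartedSpace K X] [IsManifold J ∞ X]
    [CompactSpace X] [T2Space X]
    (f : C(Y, X)) (hf : ContMDiff I J ∞ f)
    (hfb : MapsTo f (I.boundary Y) (J.boundary X)) :
    ∃ g : C(Y, X), IsNeat I J g ∧ f.HomotopicRel g (I.boundary Y) := by
  rcases hJ with hJ | ⟨k, hk, hJ⟩
  · have hX : J.boundary X = ∅ := J.boundary_eq_empty_of_range_eq_univ hJ
    have hY : I.boundary Y = ∅ := eq_empty_of_forall_notMem fun y hy ↦ by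
      have := hfb hy
      rwa [hX] at this
    exact ⟨f, ⟨hf, by rw [hX, hY, preimage_empty], by simp [hY]⟩, .refl f⟩
  rcases hI with hI | ⟨l, hl, hI⟩
  · have hY : I.boundary Y = ∅ := I.boundary_eq_empty_of_range_eq_univ hI
    obtain ⟨g, hg, hfg, hpre, -⟩ := exists_homotopicRel_normal_derivative_lt hk hJ
      (ρ := fun _ : Y ↦ 1) contMDiff_const (fun _ ↦ zero_le_one) (by simp [hY]) f hf hfb
    exact ⟨g, ⟨hg, hpre, by simp [hY]⟩, hfg⟩
  · obtain ⟨ρ, hρ, hρn, hρ0, hρd⟩ := exists_boundary_definingFunction (M := Y) hl hI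
    obtain ⟨g, hg, hfg, hpre, hlt⟩ :=
      exists_homotopicRel_normal_derivative_lt hk hJ hρ hρn hρ0 f hf hfb
    refine ⟨g, .of_apply_mfderiv_ne_zero hl hI hk hJ hg hpre fun y hy ↦ ?_, hfg⟩
    obtain ⟨m, v, hm, hlv, hmv⟩ := hρd y hy
    obtain ⟨c, hc, hfc⟩ := exists_apply_mfderiv_eq_mul hl hI hk hJ hy
      ((hf y).mdifferentiableAt (by simp)) (hfb hy)
    have h1 := hfc v
    rw [hlv, mul_one] at h1
    have h2 := hlt y hy m v hm hmv
    exact ⟨v, (hc.trans_lt (h1 ▸ h2)).ne'⟩
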